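/- Let $X$ be a finite quandle, i.e. a finite set with an operation $\triangleright$ such that every $\varphi_x\colon y\mapsto x\triangleright y$ is bijective, $x\triangleright(y\triangleright z)=(x\triangleright y)\triangleright(x\triangleright z)$ and $x\triangleright x=x$. Assume that $X$ is indecomposable, i.e. the group generated by the $\varphi_x$ acts transitively on $X$, and let $x_0\in X$. Let $G_X=\langle x\in X: xy=(x\triangleright y)x\rangle$ be the enveloping group, acting on $X$ so that the generator $x$ acts as $\varphi_x$; let $\mathrm{Stab}_{G_X}(x_0)$ be the stabilizer of $x_0$ in $G_X$ and $N_0$ the stabilizer of $x_0$ in the commutator subgroup $[G_X,G_X]$. Let $H_2^Q(X,\mathbb Z)$ be the second homology group of the complex $(C_n/C_n^D)_{n\ge 0}$, where $C_n$ is the free abelian group on $X^n$, $C_n^D$ is its subgroup generated by the tuples with $x_i=x_{i+1}$ for some $i$, and the boundary $C_{n+1}\to C_n$ is $$\partial(x_1,\dots,x_{n+1})=\sum_{i=1}^{n}(-1)^{i-1}\big((x_1,\dots,x_{i-1},x_{i+1},\dots,x_{n+1})-(x_1,\dots,x_{i-1},x_i\triangleright x_{i+1},\dots,x_i\triangleright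 x_{n+1})\big).$$ Then $$H_2^Q(X,\mathbb Z)\;\simeq\;\big([G_X,G_X]\cap \mathrm{Stab}_{G_X}(x_0)\big)_{\mathrm{ab}}\;\simeq\;(N_0)_{\mathrm{ab}}.$$ If moreover the canonical map $X\to G_X$ is injective, then also $$H_2^Q(X,\mathbb Z)\;\simeq\;\big([G_X,G_X]\cap C_{G_X}(x_0)\big)_{\mathrm{ab}}\;\simeq\;(N_0)_{\mathrm{ab}},$$ where $C_{G_X}(x_0)$ is the centralizer in $G_X$ of the image of $x_0$. -/

import Mathlib

namespace QuandleHomology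

open Quandles

/-- A rack is indecomposable if its inner group, the subgroup of the symmetric group generated
by all left translations `φ_x : y ↦ x ◃ y`, acts transitively. -/
def IsIndecomposable (X : Type*) [Rack X] : Prop :=
  MulAction.IsPretransitive
    (Subgroup.closure (Set.range fun x : X => (Rack.act' x : Equiv.Perm X))) X

/-- The canonical map `X → G_X` to the enveloping group `G_X = ⟨x ∈ X : x y = (x ◃ y) x⟩`. -/
def toG (X : Type*) [Rack X] (x : X) : Rack.EnvelGroup X := Rack.toEnvelGroup X x

/-- The commutator subgroup `N_X = [G_X, G_X]` of the enveloping group. -/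
abbrev N (X : Type*) [Rack X] : Subgroup (Rack.EnvelGroup X) := commutator (Rack.EnvelGroup X)

/-- The stabilizer of `x₀` for the action of `G_X` on `X`, in which the generator `x` acts
by `y ↦ x ◃ y`. -/
def stab {X : Type*} [Rack X] (x₀ : X) : Subgroup (Rack.EnvelGroup X) :=
  (MulAction.stabilizer (Equiv.Perm X) x₀).comap (Rack.envelAction (R := X))

/-- The stabilizer `N₀` of `x₀` for the action of `N_X` on `X`. -/
def N₀ {X : Type*} [Rack X] (x₀ : X) : Subgroup (N X) := (stab x₀).subgroupOf (N X)

/-- The free abelian group `F_n(X)` on `X^n`. -/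
abbrev Chain (X : Type*) (n : ℕ) : Type _ := (Fin n → X) →₀ ℤ

/-- `(x_0, …, x_n) ↦ (x_0, …, x_{i-1}, x_{i+1}, …, x_n)`. -/
def face₀ {X : Type*} {n : ℕ} (i : Fin (n + 1)) (x : Fin (n + 1) → X) : Fin n → X :=
  fun j => x (i.succAbove j)

/-- `(x_0, …, x_n) ↦ (x_0, …, x_{i-1}, x_i ◃ x_{i+1}, …, x_i ◃ x_n)`. -/
def face₁ {X : Type*} [Shelf X] {n : ℕ} (i : Fin (n + 1)) (x : Fin (n + 1) → X) : Fin n → X :=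
  fun j => if j.castSucc < i then x (i.succAbove j) else x i ◃ x (i.succAbove j)

/-- The rack boundary `F_{n+1}(X) → F_n(X)`: an `(n+1)`-tuple goes to the alternating sum of
`(x_1, …, x_{i-1}, x_{i+1}, …) - (x_1, …, x_{i-1}, x_i ◃ x_{i+1}, …)` over `i = 1, …, n`. -/
noncomputable def boundary (X : Type*) [Shelf X] (n : ℕ) : Chain X (n + 1) →ₗ[ℤ] Chain X n :=
  Finsupp.linearCombination ℤ fun x : Fin (n + 1) → X =>
    ∑ i : Fin n, (-1 : ℤ) ^ (i : ℕ) •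
      (Finsupp.single (face₀ i.castSucc x) (1 : ℤ) - Finsupp.single (face₁ i.castSucc x) 1)

/-- A tuple is degenerate if two consecutive entries agree. -/
def IsDegenerate {X : Type*} {n : ℕ} (x : Fin n → X) : Prop :=
  ∃ i j : Fin n, (j : ℕ) = i + 1 ∧ x i = x j

/-- The subgroup `F_n^D(X)` generated by the degenerate tuples. -/
noncomputable def degenerate (X : Type*) (n : ℕ) : Submodule ℤ (Chain X n) :=
  Submodule.span ℤ {c | ∃ x : Fin n → X, IsDegenerate x ∧ c = Finsupp.single x 1}

theorem single_mem_degenerate {X : Type*} {n : ℕ} {x : Fin n → X} (h : IsDegenerate x) :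
    (Finsupp.single x 1 : Chain X n) ∈ degenerate X n :=
  Submodule.subset_span ⟨x, h, rfl⟩

theorem face₀_eq_face₁_last {X : Type*} [Shelf X] {n : ℕ} (x : Fin (n + 1) → X) :
    face₀ (Fin.last n) x = face₁ (Fin.last n) x := by
  funext j
  simp [face₀, face₁, Fin.castSucc_lt_last]

theorem boundary_single (X : Type*) [Shelf X] (n : ℕ) (x : Fin (n + 1) → X) :
    boundary X n (Finsupp.single x 1) = ∑ i : Fin (n + 1), (-1 : ℤ) ^ (i : ℕ) •
      (Finsupp.single (face₀ i x) (1 : ℤ) - Finsupp.single (face₁ i x) 1) := by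
  rw [Fin.sum_univ_castSucc]
  simp [boundary, face₀_eq_face₁_last]

/-- The difference of the two `i`-th faces, as a map of chain groups. -/
noncomputable def faceDiff (X : Type*) [Shelf X] {n : ℕ} (i : Fin (n + 1)) :
    Chain X (n + 1) →ₗ[ℤ] Chain X n :=
  Finsupp.lmapDomain ℤ ℤ (face₀ i) - Finsupp.lmapDomain ℤ ℤ (face₁ i)

theorem boundary_eq (X : Type*) [Shelf X] (n : ℕ) :
    boundary X n = ∑ i : Fin (n + 1), (-1 : ℤ) ^ (i : ℕ) • faceDiff X i := by
  refine Finsupp.lhom_ext' fun x => LinearMap.ext_ring ?_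
  simp [boundary_single, faceDiff]

theorem faceDiff_comp (X : Type*) [Shelf X] {n : ℕ} {i j : Fin (n + 1)} (h : i ≤ j) :
    faceDiff X i ∘ₗ faceDiff X j.succ = faceDiff X j ∘ₗ faceDiff X i.castSucc := by
  rw [Fin.le_def] at h
  have key : ∀ (k : Fin n) (x : Fin (n + 2) → X),
      face₀ i (face₀ j.succ x) k = face₀ j (face₀ i.castSucc x) k ∧
      face₀ i (face₁ j.succ x) k = face₁ j (face₀ i.castSucc x) k ∧
      face₁ i (face₀ j.succ x) k = face₀ j (face₁ i.castSucc x) k ∧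
      face₁ i (face₁ j.succ x) k = face₁ j (face₁ i.castSucc x) k := by
    intro k x
    have hj : j.succ.succAbove i = i.castSucc := by
      rw [Fin.succAbove_of_castSucc_lt]; rw [Fin.lt_def]; simp; omega
    have hi : i.castSucc.succAbove j = j.succ := by
      rw [Fin.succAbove_of_le_castSucc]; rw [Fin.le_def]; simpa using h
    simp only [face₀, face₁, hi, hj]
    rcases lt_or_ge (k : ℕ) i with h1 | h1
    · have h2 : (k : ℕ) < j := by omega
      have a1 : i.succAbove k = k.castSucc := Fin.succAbove_of_castSucc_lt _ _ h1
      have a2 : j.succAbove k = k.castSucc := Fin.succAbove_of_castSucc_lt _ _ h2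
      have a3 : j.succ.succAbove k.castSucc = k.castSucc.castSucc :=
        Fin.succAbove_of_castSucc_lt _ _ (by rw [Fin.lt_def]; simp; omega)
      have a4 : i.castSucc.succAbove k.castSucc = k.castSucc.castSucc :=
        Fin.succAbove_of_castSucc_lt _ _ (by rw [Fin.lt_def]; simp; omega)
      simp [a1, a2, a3, a4, Fin.lt_def, h1, h2, show (k : ℕ) < j + 1 by omega]
    · have a1 : i.succAbove k = k.succ := Fin.succAbove_of_le_castSucc _ _ h1
      rcases lt_or_ge (k : ℕ) j with h2 | h2
      · have a2 : j.succAbove k = k.castSucc := Fin.succAbove_of_castSucc_lt _ _ h2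
        have a3 : j.succ.succAbove k.succ = k.succ.castSucc :=
          Fin.succAbove_of_castSucc_lt _ _ (by rw [Fin.lt_def]; simp; omega)
        have a4 : i.castSucc.succAbove k.castSucc = k.castSucc.succ :=
          Fin.succAbove_of_le_castSucc _ _ (by rw [Fin.le_def]; simp; omega)
        simp [a1, a2, a3, a4, Fin.lt_def, h2, show ¬ (k : ℕ) < i by omega,
          show (i : ℕ) < j + 1 by omega]
      · have a2 : j.succAbove k = k.succ := Fin.succAbove_of_le_castSucc _ _ h2
        have a3 : j.succ.succAbove k.succ = k.succ.succ :=
          Fin.succAbove_of_le_castSucc _ _ (by rw [Fin.le_def]; simp; omega)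
        have a4 : i.castSucc.succAbove k.succ = k.succ.succ :=
          Fin.succAbove_of_le_castSucc _ _ (by rw [Fin.le_def]; simp; omega)
        simp only [a1, a2, a3, a4, Fin.lt_def, Fin.val_castSucc, Fin.val_succ,
          show ¬ (k : ℕ) < i by omega, show ¬ (k : ℕ) < j by omega, show (i : ℕ) < j + 1 by omega,
          show ¬ (k : ℕ) + 1 < i by omega, show ¬ (k : ℕ) + 1 < j + 1 by omega,
          show ¬ (j : ℕ) < i by omega, if_true, if_false, true_and]
        exact Shelf.self_distrib
  refine Finsupp.lhom_ext' fun x => LinearMap.ext_ring ?_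
  have e1 := funext fun k => (key k x).1
  have e2 := funext fun k => (key k x).2.1
  have e3 := funext fun k => (key k x).2.2.1
  have e4 := funext fun k => (key k x).2.2.2
  simp only [faceDiff, LinearMap.coe_comp, Function.comp_apply, LinearMap.sub_apply,
    Finsupp.lsingle_apply, Finsupp.lmapDomain_apply, Finsupp.mapDomain_single, map_sub,
    e1, e2, e3, e4]
  abel

/-- The rack chains form a complex. -/
theorem boundary_comp (X : Type*) [Shelf X] (n : ℕ) :
    boundary X n ∘ₗ boundary X (n + 1) = 0 := by
  rw [boundary_eq, boundary_eq]
  refine LinearMap.ext fun c => ?_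
  simp only [LinearMap.comp_apply, LinearMap.sum_apply, map_sum, LinearMap.smul_apply, map_smul,
    Finset.smul_sum, smul_smul, LinearMap.zero_apply]
  rw [← Finset.sum_product']
  let P := Fin (n + 2) × Fin (n + 1)
  let S : Finset P := {ij : P | (ij.1 : ℕ) ≤ (ij.2 : ℕ)}
  rw [Finset.univ_product_univ, ← Finset.sum_add_sum_compl S, ← eq_neg_iff_add_eq_zero,
    ← Finset.sum_neg_distrib]
  let φ : ∀ ij : P, ij ∈ S → P := fun ij hij =>
    (ij.2.succ, Fin.castLT ij.1 (lt_of_le_of_lt (Finset.mem_filter.mp hij).right ij.2.isLt))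
  refine Finset.sum_bij φ ?_ ?_ ?_ ?_
  · intro ij hij
    simp_rw [S, φ, Finset.compl_filter, Finset.mem_filter_univ, Fin.val_succ,
      Fin.val_castLT] at hij ⊢
    omega
  · rintro ⟨i, j⟩ hij ⟨i', j'⟩ hij' h
    have h1 : (j : ℕ) + 1 = j' + 1 := congrArg (fun p : P => (p.1 : ℕ)) h
    have h2 : (i : ℕ) = i' := congrArg (fun p : P => (p.2 : ℕ)) h
    exact Prod.ext (Fin.ext h2) (Fin.ext (by simpa using h1))
  · rintro ⟨i', j'⟩ hij'
    simp_rw [S, Finset.compl_filter, Finset.mem_filter_univ, not_le] at hij'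
    refine ⟨(Fin.castSucc j', i'.pred ?_), ?_, ?_⟩
    · rintro rfl
      simp at hij'
    · simp only [S, Finset.mem_filter_univ, Fin.val_castSucc, Fin.val_pred]
      omega
    · simp only [φ, Fin.castLT_castSucc, Fin.succ_pred]
  · rintro ⟨i, j⟩ hij
    have hij' : (i : ℕ) ≤ j := by simpa [S] using hij
    have hlt : (i : ℕ) < n + 1 := by omega
    have h := LinearMap.congr_fun
      (faceDiff_comp X (i := i.castLT hlt) (j := j) (Fin.le_def.2 (by simpa using hij'))) c
    simp only [LinearMap.comp_apply, Fin.castSucc_castLT] at h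
    simp only [φ, h, Fin.val_succ, Fin.val_castLT, ← neg_smul]
    congr 1
    ring

/-- The degenerate chains of a quandle form a subcomplex. -/
theorem degenerate_le (X : Type*) [Quandle X] (n : ℕ) :
    degenerate X (n + 1) ≤ (degenerate X n).comap (boundary X n) := by
  refine Submodule.span_le.2 ?_
  rintro _ ⟨x, ⟨a, b, hab, hx⟩, rfl⟩
  simp only [Submodule.comap_coe, Set.mem_preimage, SetLike.mem_coe]
  rw [boundary_single]
  have hne : a ≠ b := by rintro rfl; omega
  have h₀ : face₀ a x = face₀ b x := by
    funext j
    simp only [face₀, Fin.succAbove, Fin.lt_def, Fin.val_castSucc]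
    by_cases h1 : (j : ℕ) < a
    · simp [h1, show (j : ℕ) < b by omega]
    · by_cases h2 : (j : ℕ) < b
      · have e1 : j.succ = b := by ext; simp; omega
        have e2 : j.castSucc = a := by ext; simp; omega
        simp [h1, h2, e1, e2, hx]
      · simp [h1, h2]
  have h₁ : face₁ a x = face₁ b x := by
    funext j
    simp only [face₁, Fin.succAbove, Fin.lt_def, Fin.val_castSucc]
    by_cases h1 : (j : ℕ) < a
    · simp [h1, show (j : ℕ) < b by omega]
    · by_cases h2 : (j : ℕ) < b
      · have e1 : j.succ = b := by ext; simp; omega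
        have e2 : j.castSucc = a := by ext; simp; omega
        simp [h1, h2, e1, e2, hx]
      · simp [h1, h2, hx]
  have hdeg : ∀ i : Fin (n + 1), i ≠ a → i ≠ b →
      IsDegenerate (face₀ i x) ∧ IsDegenerate (face₁ i x) := by
    intro i hia hib
    have hia' : (i : ℕ) ≠ a := fun h => hia (Fin.ext h)
    have hib' : (i : ℕ) ≠ b := fun h => hib (Fin.ext h)
    have hbn := b.isLt
    have hin := i.isLt
    by_cases h : (i : ℕ) < a
    · have e1 : (⟨a - 1, by omega⟩ : Fin n).succ = a := by ext; simp; omega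
      have e2 : (⟨a, by omega⟩ : Fin n).succ = b := by ext; simp; omega
      refine ⟨⟨⟨a - 1, by omega⟩, ⟨a, by omega⟩, by simp; omega, ?_⟩,
        ⟨⟨a - 1, by omega⟩, ⟨a, by omega⟩, by simp; omega, ?_⟩⟩ <;>
      simp only [face₀, face₁, Fin.succAbove, Fin.lt_def, Fin.val_castSucc, e1, e2] <;>
      simp [show ¬ ((a : ℕ) - 1 < i) by omega, show ¬ ((a : ℕ) < i) by omega, hx]
    · have e1 : (⟨a, by omega⟩ : Fin n).castSucc = a := by ext; simp
      have e2 : (⟨a + 1, by omega⟩ : Fin n).castSucc = b := by ext; simp; omega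
      refine ⟨⟨⟨a, by omega⟩, ⟨a + 1, by omega⟩, by simp, ?_⟩,
        ⟨⟨a, by omega⟩, ⟨a + 1, by omega⟩, by simp, ?_⟩⟩ <;>
      simp only [face₀, face₁, Fin.succAbove, Fin.lt_def, e1, e2] <;>
      simp [show b < i from Fin.lt_def.2 (by omega), show (a : ℕ) < i by omega, hx]
  rw [← Finset.add_sum_erase _ _ (Finset.mem_univ a),
    ← Finset.add_sum_erase _ _ (Finset.mem_erase.2 ⟨hne.symm, Finset.mem_univ b⟩), ← add_assoc]
  refine Submodule.add_mem _ ?_ (Submodule.sum_mem _ fun i hi => ?_)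
  · rw [h₀, h₁, hab, pow_succ]
    simp
  · simp only [Finset.mem_erase, Finset.mem_univ, and_true] at hi
    exact Submodule.smul_mem _ _ (Submodule.sub_mem _
      (single_mem_degenerate (hdeg i hi.2 hi.1).1) (single_mem_degenerate (hdeg i hi.2 hi.1).2))

/-- The quandle chain group `C_n^Q(X) = F_n(X) / F_n^D(X)`. -/
abbrev QChain (X : Type*) (n : ℕ) : Type _ := Chain X n ⧸ degenerate X n

/-- The induced boundary `C_{n+1}^Q(X) → C_n^Q(X)`. -/
noncomputable def qBoundary (X : Type*) [Quandle X] (n : ℕ) :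
    QChain X (n + 1) →ₗ[ℤ] QChain X n :=
  (degenerate X (n + 1)).mapQ (degenerate X n) (boundary X n) (degenerate_le X n)

/-- The quandle chains form a complex. -/
theorem qBoundary_comp (X : Type*) [Quandle X] (n : ℕ) :
    qBoundary X n ∘ₗ qBoundary X (n + 1) = 0 := by
  refine Submodule.linearMap_qext _ (LinearMap.ext fun c => ?_)
  have h : boundary X n (boundary X (n + 1) c) = 0 := LinearMap.congr_fun (boundary_comp X n) c
  simp [qBoundary, h]

/-- The quandle homology group `H_{n+1}^Q(X, ℤ)`: cycles in `C_{n+1}^Q(X)` modulo boundaries. -/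
abbrev HQSucc (X : Type*) [Quandle X] (n : ℕ) : Type _ :=
  LinearMap.ker (qBoundary X n) ⧸
    (LinearMap.range (qBoundary X (n + 1))).submoduleOf (LinearMap.ker (qBoundary X n))

/-- The second quandle homology group `H_2^Q(X, ℤ)`. -/
abbrev H2Q (X : Type*) [Quandle X] : Type _ := HQSucc X 1

end QuandleHomology

/-!
Consider the graph with vertex set `X` and an edge `x : z → x ◃ z` for every pair `(x, z)`. Up to
sign, the boundary `C₂ → C₁` is the boundary of this graph, and the boundary of `(x, y, z)` is the
square which compares the two sides of the relation `x y = (x ◃ y) x` at the vertex `z`. So the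
graph with these squares is the covering, with fibre `X`, of the presentation complex of `G_X`. If
`X` is indecomposable, it is connected, its fundamental group is `Stab(x₀)`, and the rack homology
is the abelianization of that group. Passing to quandle chains kills the loops `(x, x)`, which are
all conjugate to the element `x₀` of `Stab(x₀)`. This element is central in `Stab(x₀)`
(`commute_toG_of_mem_stab`) and has degree `1`, whereas `[G_X, G_X]` is the kernel of the degree
(`mem_N_iff_degree_eq_one`), so that `Stab(x₀)` is the direct product of
`[G_X, G_X] ∩ Stab(x₀)` and `⟨x₀⟩`, and killing `x₀` leaves the abelianization of the first factor.

The proof makes this explicit without covering theory. Let `A` be the group of quandle `2`-chains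
modulo boundaries.
* The relations of `G_X` hold for the permutations `(z, a) ↦ (x ◃ z, a + (x, z))` of `X × A`. The
  resulting action of `G_X` on `X × A` assigns to each group element `g` and vertex `z` the class
  `pathClass g z` of the path spelled by `g` at `z`; on `Stab(x₀)`, with `z = x₀`, this is a
  homomorphism `fromStab`.
* Choosing `s z ∈ G_X` with `s z · x₀ = z` turns an edge `x : z → x ◃ z` into the element
  `(s (x ◃ z))⁻¹ x (s z)` of `Stab(x₀)`, and gives a homomorphism `toStab` from `A` to the
  abelianization of `[G_X, G_X] ∩ Stab(x₀)`.

Both maps come from cocycles on `G_X`, which are determined by their values on generators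
(`IsCocycle.ext`). This shows that `toStab` inverts `fromStab` on one side
(`toStab_pathClass_base`), and that `fromStab` after `toStab` adds to a chain a term depending on
its boundary only (`fromStab_toStab`); on cycles the two are therefore mutually inverse.

If `X → G_X` is injective, `g` fixes `x₀` in `X` if and only if it commutes with `x₀` in `G_X`
(`stab_eq_centralizer`).
-/

namespace QuandleHomology

open Quandles


/-! ### The enveloping group and its degree map -/

section EnvelopingGroup

variable {X : Type*} [Rack X]

theorem envelGroup_induction {p : Rack.EnvelGroup X → Prop} (one : p 1)
    (gen : ∀ x, p (toG X x)) (mul : ∀ g h, p g → p h → p (g * h))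
    (inv : ∀ g, p g → p g⁻¹) (g : Rack.EnvelGroup X) : p g := by
  refine Quotient.inductionOn g fun a => ?_
  induction a with
  | unit => exact one
  | incl x => exact gen x
  | mul a b ha hb => exact mul _ _ ha hb
  | inv a ha => exact inv _ ha

theorem envelAction_toG (x y : X) : Rack.envelAction (toG X x) y = x ◃ y := rfl

theorem toG_act (x y : X) : toG X (x ◃ y) = toG X x * toG X y * (toG X x)⁻¹ :=
  (Rack.toEnvelGroup X).map_act

theorem toG_envelAction (g : Rack.EnvelGroup X) (y : X) :
    toG X (Rack.envelAction g y) = g * toG X y * g⁻¹ := by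
  induction g using envelGroup_induction generalizing y with
  | one => simp
  | gen x => rw [envelAction_toG, toG_act]
  | mul g h hg hh => simp [hg, hh, mul_assoc]
  | inv g hg =>
    have h := hg (Rack.envelAction g⁻¹ y)
    rw [← Equiv.Perm.mul_apply, ← map_mul, mul_inv_cancel, map_one, Equiv.Perm.one_apply] at h
    rw [h]
    group

theorem mem_stab {x₀ : X} {g : Rack.EnvelGroup X} :
    g ∈ stab x₀ ↔ Rack.envelAction g x₀ = x₀ := Iff.rfl

/-- The generator `x₀` is central in the stabilizer of `x₀`. -/
theorem commute_toG_of_mem_stab {x₀ : X} {g : Rack.EnvelGroup X} (hg : g ∈ stab x₀) :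
    Commute (toG X x₀) g := by
  have h := toG_envelAction g x₀
  rw [mem_stab.1 hg] at h
  exact eq_mul_inv_iff_mul_eq.1 h

theorem stab_eq_centralizer (h : Function.Injective (toG X)) (x₀ : X) :
    stab x₀ = Subgroup.centralizer {toG X x₀} := by
  ext g
  rw [Subgroup.mem_centralizer_singleton_iff, mem_stab, ← h.eq_iff, toG_envelAction,
    mul_inv_eq_iff_eq_mul]

theorem exists_envelAction_eq (hX : IsIndecomposable X) (x₀ y : X) :
    ∃ g : Rack.EnvelGroup X, Rack.envelAction g x₀ = y := by
  obtain ⟨⟨σ, hσ⟩, h⟩ := hX.exists_smul_eq x₀ y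
  have hle : Subgroup.closure (Set.range fun x : X => (Rack.act' x : Equiv.Perm X)) ≤
      (Rack.envelAction (R := X)).range := by
    rw [Subgroup.closure_le]
    rintro _ ⟨x, rfl⟩
    exact ⟨toG X x, rfl⟩
  obtain ⟨g, rfl⟩ := hle hσ
  exact ⟨g, h⟩

/-- The degree map of the enveloping group, which sends every generator to `1`. -/
def degree : Rack.EnvelGroup X →* Multiplicative ℤ :=
  Rack.toEnvelGroup.map
    { toFun := fun _ => Multiplicative.ofAdd 1
      map_act' := by simp }

theorem degree_toG (x : X) : degree (toG X x) = Multiplicative.ofAdd 1 := rfl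

/-- If `X` is indecomposable, all generators of `G_X` are conjugate, so the abelianization of
`G_X` is generated by the class of any one of them. -/
theorem abelianization_of_eq_zpow_degree (hX : IsIndecomposable X) (x₀ : X)
    (g : Rack.EnvelGroup X) :
    Abelianization.of g = Abelianization.of (toG X x₀) ^ (degree g).toAdd := by
  induction g using envelGroup_induction with
  | one => simp
  | gen x =>
    obtain ⟨h, rfl⟩ := exists_envelAction_eq hX x₀ x
    rw [degree_toG, toG_envelAction]
    simp
  | mul g h hg hh => rw [map_mul, map_mul, hg, hh, toAdd_mul, zpow_add]
  | inv g hg => rw [map_inv, map_inv, hg, toAdd_inv, zpow_neg]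

theorem mem_N_iff_degree_eq_one (hX : IsIndecomposable X) (x₀ : X) {g : Rack.EnvelGroup X} :
    g ∈ N X ↔ degree g = 1 := by
  refine ⟨fun h => Abelianization.commutator_subset_ker degree h, fun h => ?_⟩
  rw [N, ← Abelianization.ker_of, MonoidHom.mem_ker, abelianization_of_eq_zpow_degree hX x₀, h]
  simp

end EnvelopingGroup

section Retraction

variable {X : Type*} [Quandle X]

theorem toG_mem_stab (x₀ : X) : toG X x₀ ∈ stab x₀ := Quandle.fix

/-- The retraction `g ↦ g x₀^{-deg g}` of the stabilizer of `x₀` onto its intersection with the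
commutator subgroup. Its kernel is generated by the central element `x₀`. -/
def stabRetraction (hX : IsIndecomposable X) (x₀ : X) :
    ↥(stab x₀) →* ↥(N X ⊓ stab x₀) where
  toFun g := ⟨g * toG X x₀ ^ (-(degree (g : Rack.EnvelGroup X)).toAdd), by
    refine Subgroup.mem_inf.2 ⟨(mem_N_iff_degree_eq_one hX x₀).2 ?_,
      mul_mem g.2 (zpow_mem (toG_mem_stab x₀) _)⟩
    rw [map_mul, map_zpow, degree_toG, ← ofAdd_zsmul]
    simp⟩
  map_one' := by ext; simp
  map_mul' g h := by
    ext
    have hc : Commute (toG X x₀ ^ (-(degree (g : Rack.EnvelGroup X)).toAdd))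
        (h : Rack.EnvelGroup X) := (commute_toG_of_mem_stab h.2).zpow_left _
    simp only [Subgroup.coe_mul, map_mul, toAdd_mul, neg_add, zpow_add]
    rw [mul_assoc, mul_assoc, hc.left_comm]

theorem coe_stabRetraction (hX : IsIndecomposable X) (x₀ : X) (g : ↥(stab x₀)) :
    (stabRetraction hX x₀ g : Rack.EnvelGroup X) =
      g * toG X x₀ ^ (-(degree (g : Rack.EnvelGroup X)).toAdd) := rfl

theorem stabRetraction_of_mem (hX : IsIndecomposable X) (x₀ : X) (k : ↥(N X ⊓ stab x₀)) :
    stabRetraction hX x₀ ⟨k, k.2.2⟩ = k := by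
  ext
  simp [coe_stabRetraction, (mem_N_iff_degree_eq_one hX x₀).1 k.2.1]

theorem stabRetraction_toG (hX : IsIndecomposable X) (x₀ : X) :
    stabRetraction hX x₀ ⟨toG X x₀, toG_mem_stab x₀⟩ = 1 := by
  ext
  simp [coe_stabRetraction, degree_toG]

end Retraction

/-! ### Cocycles for the action of the enveloping group -/

section Cocycle

variable {X : Type*} [Rack X] {A : Type*} [AddCommGroup A]

/-- A crossed homomorphism `G_X → A^X`; equivalently, an `A`-valued functor on the action
groupoid of `G_X` on `X`, where `d g z` is the value on the arrow `g : z → g z`. -/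
def IsCocycle (d : Rack.EnvelGroup X → X → A) : Prop :=
  ∀ g h z, d (g * h) z = d g (Rack.envelAction h z) + d h z

namespace IsCocycle

variable {d e : Rack.EnvelGroup X → X → A}

theorem one (hd : IsCocycle d) (z : X) : d 1 z = 0 := by
  simpa using hd 1 1 z

theorem inv (hd : IsCocycle d) (g : Rack.EnvelGroup X) (z : X) :
    d g⁻¹ z = -d g (Rack.envelAction g⁻¹ z) := by
  have h := hd g g⁻¹ z
  rw [mul_inv_cancel, hd.one] at h
  exact eq_neg_of_add_eq_zero_right h.symm

theorem ext (hd : IsCocycle d) (he : IsCocycle e)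
    (h : ∀ x z, d (toG X x) z = e (toG X x) z) (g : Rack.EnvelGroup X) (z : X) :
    d g z = e g z := by
  induction g using envelGroup_induction generalizing z with
  | one => rw [hd.one, he.one]
  | gen x => exact h x z
  | mul g g' hg hg' => rw [hd, he, hg, hg']
  | inv g hg => rw [hd.inv, he.inv, hg]

theorem map {B : Type*} [AddCommGroup B] (hd : IsCocycle d) (f : A →ₗ[ℤ] B) :
    IsCocycle fun g z => f (d g z) := fun g h z => by
  simp only [hd g h z, map_add]

/-- The restriction of a cocycle to the stabilizer of a point is a homomorphism. -/
def stabHom (hd : IsCocycle d) (x₀ : X) : ↥(stab x₀) →* Multiplicative A where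
  toFun g := Multiplicative.ofAdd (d g x₀)
  map_one' := by simp [hd.one]
  map_mul' g h := by
    rw [Subgroup.coe_mul, hd, mem_stab.1 h.2, ofAdd_add]

end IsCocycle

/-- Weights `w x z` on the edges `x : z → x ◃ z` whose sums along the two sides of every square
`x y = (x ◃ y) x` agree. -/
def IsEdgeCocycle (w : X → X → A) : Prop :=
  ∀ x y z, w x (y ◃ z) + w y z = w (x ◃ y) (x ◃ z) + w x z

/-- The generator `x` acts on `X × A` by running along the edge `x : z → x ◃ z` and adding its
weight to the `A`-coordinate. -/
def edgePerm (w : X → X → A) (x : X) : Equiv.Perm (X × A) where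
  toFun p := (x ◃ p.1, p.2 + w x p.1)
  invFun p := (x ◃⁻¹ p.1, p.2 - w x (x ◃⁻¹ p.1))
  left_inv p := by simp
  right_inv p := by simp

/-- The action of the enveloping group on `X × A` given by an edge cocycle. -/
def edgeAction {w : X → X → A} (hw : IsEdgeCocycle w) :
    Rack.EnvelGroup X →* Equiv.Perm (X × A) :=
  Rack.toEnvelGroup.map
    { toFun := edgePerm w
      map_act' := by
        intro x y
        rw [Quandle.conj_act_eq_conj, eq_mul_inv_iff_mul_eq]
        ext p
        · exact Shelf.self_distrib.symm
        · change p.2 + w x p.1 + w (x ◃ y) (x ◃ p.1) = p.2 + w y p.1 + w x (y ◃ p.1)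
          rw [add_assoc, add_assoc, add_comm (w y p.1), hw, add_comm (w x p.1)] }

/-- The extension of an edge cocycle to all of the enveloping group. -/
def extend {w : X → X → A} (hw : IsEdgeCocycle w) (g : Rack.EnvelGroup X) (z : X) : A :=
  (edgeAction hw g (z, 0)).2

theorem edgeAction_apply {w : X → X → A} (hw : IsEdgeCocycle w) (g : Rack.EnvelGroup X)
    (z : X) (a : A) :
    edgeAction hw g (z, a) = (Rack.envelAction g z, a + extend hw g z) := by
  -- The action covers the one on `X` and commutes with translations of `A`.
  have key : ∀ (z : X) (a : A), (edgeAction hw g (z, a)).1 = Rack.envelAction g z ∧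
      ∀ b, edgeAction hw g (z, a + b) =
        ((edgeAction hw g (z, b)).1, a + (edgeAction hw g (z, b)).2) := by
    induction g using envelGroup_induction with
    | one => simp
    | gen x =>
      exact fun z a => ⟨rfl, fun b => Prod.ext rfl (add_assoc a b _)⟩
    | mul g h hg hh =>
      refine fun z a => ⟨?_, fun b => ?_⟩
      · rw [map_mul, map_mul, Equiv.Perm.mul_apply, Equiv.Perm.mul_apply, ← (hh z a).1]
        exact (hg _ _).1
      · simp only [map_mul, Equiv.Perm.mul_apply]
        rw [(hh z a).2 b, (hg _ a).2]
    | inv g hg =>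
      have hinv : ∀ p, edgeAction hw g (edgeAction hw g⁻¹ p) = p := fun p => by
        rw [← Equiv.Perm.mul_apply, ← map_mul, mul_inv_cancel, map_one, Equiv.Perm.one_apply]
      refine fun z a => ⟨?_, fun b => ?_⟩
      · apply (Rack.envelAction g).injective
        rw [← (hg _ (edgeAction hw g⁻¹ (z, a)).2).1, Prod.mk.eta, hinv, ← Equiv.Perm.mul_apply,
          ← map_mul, mul_inv_cancel, map_one, Equiv.Perm.one_apply]
      · apply (edgeAction hw g).injective
        rw [hinv, (hg _ a).2, Prod.mk.eta, hinv]
  have h := (key z a).2 0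
  rw [add_zero, (key z 0).1] at h
  exact h

theorem extend_toG {w : X → X → A} (hw : IsEdgeCocycle w) (x z : X) :
    extend hw (toG X x) z = w x z := zero_add _

theorem isCocycle_extend {w : X → X → A} (hw : IsEdgeCocycle w) : IsCocycle (extend hw) := by
  intro g h z
  have : edgeAction hw (g * h) (z, 0) = edgeAction hw g (edgeAction hw h (z, 0)) := by
    rw [map_mul, Equiv.Perm.mul_apply]
  rw [edgeAction_apply, edgeAction_apply, edgeAction_apply] at this
  simpa [add_comm] using congrArg Prod.snd this

end Cocycle

/-! ### Chains modulo boundaries in degree two -/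

section Vertices

variable {X : Type*}

/-- The class of a vertex in the `1`-chains. -/
noncomputable def vertex (z : X) : QChain X 1 :=
  Submodule.Quotient.mk (Finsupp.single ![z] 1)

/-- A function on the vertices is a homomorphism on `1`-chains: there are no degenerate
`1`-chains. -/
noncomputable def liftVertex {M : Type*} [AddCommGroup M] (t : X → M) : QChain X 1 →ₗ[ℤ] M :=
  (degenerate X 1).liftQ (Finsupp.linearCombination ℤ fun p : Fin 1 → X => t (p 0)) (by
    refine Submodule.span_le.2 ?_
    rintro _ ⟨p, ⟨i, j, hij, -⟩, rfl⟩
    omega)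

theorem liftVertex_vertex {M : Type*} [AddCommGroup M] (t : X → M) (z : X) :
    liftVertex t (vertex z) = t z := by
  change Finsupp.linearCombination ℤ (fun p : Fin 1 → X => t (p 0))
    (Finsupp.single ![z] 1) = _
  simp

end Vertices

section Chains

variable (X : Type*) [Quandle X]

/-- Quandle `2`-chains modulo boundaries. -/
abbrev ChainModBoundary : Type _ := QChain X 2 ⧸ LinearMap.range (qBoundary X 2)

/-- The boundary map on `2`-chains modulo boundaries. -/
noncomputable def boundaryBar : ChainModBoundary X →ₗ[ℤ] QChain X 1 :=
  (LinearMap.range (qBoundary X 2)).liftQ (qBoundary X 1)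
    (LinearMap.range_le_ker_iff.2 (qBoundary_comp X 1))

variable {X}

/-- The class of the edge `x : z → x ◃ z`, that is, of the pair `(x, z)`. -/
noncomputable def edge (x z : X) : ChainModBoundary X :=
  Submodule.Quotient.mk (Submodule.Quotient.mk (Finsupp.single ![x, z] 1))

theorem qBoundary_mk (n : ℕ) (c : Chain X (n + 1)) :
    qBoundary X n (Submodule.Quotient.mk c) = Submodule.Quotient.mk (boundary X n c) := rfl

theorem boundary_pair (x z : X) : boundary X 1 (Finsupp.single ![x, z] 1) =
    Finsupp.single ![z] 1 - Finsupp.single ![x ◃ z] 1 := by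
  have h₀ : face₀ (0 : Fin 2) ![x, z] = ![z] := by
    funext i; fin_cases i; rfl
  have h₁ : face₁ (0 : Fin 2) ![x, z] = ![x ◃ z] := by
    funext i; fin_cases i; rfl
  simp [boundary, h₀, h₁]

theorem boundary_triple (x y z : X) : boundary X 2 (Finsupp.single ![x, y, z] 1) =
    (Finsupp.single ![y, z] 1 - Finsupp.single ![x ◃ y, x ◃ z] 1) -
      (Finsupp.single ![x, z] 1 - Finsupp.single ![x, y ◃ z] 1) := by
  have h₀ : face₀ (0 : Fin 3) ![x, y, z] = ![y, z] := by
    funext i; fin_cases i <;> rfl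
  have h₁ : face₁ (0 : Fin 3) ![x, y, z] = ![x ◃ y, x ◃ z] := by
    funext i; fin_cases i <;> rfl
  have h₂ : face₀ (1 : Fin 3) ![x, y, z] = ![x, z] := by
    funext i; fin_cases i <;> rfl
  have h₃ : face₁ (1 : Fin 3) ![x, y, z] = ![x, y ◃ z] := by
    funext i; fin_cases i <;> rfl
  simp [boundary, Fin.sum_univ_two, h₀, h₁, h₂, h₃]
  abel

theorem boundaryBar_edge (x z : X) : boundaryBar X (edge x z) = vertex z - vertex (x ◃ z) := by
  change qBoundary X 1 (Submodule.Quotient.mk _) = _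
  rw [qBoundary_mk, boundary_pair]
  rfl

/-- The edge `(x, x)` is degenerate. -/
theorem edge_self (x : X) : edge x x = 0 := by
  have h : (Submodule.Quotient.mk (Finsupp.single ![x, x] 1) : QChain X 2) = 0 :=
    (Submodule.Quotient.mk_eq_zero _).2 (single_mem_degenerate ⟨0, 1, rfl, rfl⟩)
  rw [edge, h, Submodule.Quotient.mk_zero]

/-- The boundary of `(x, y, z)` compares the two sides of the square `x y = (x ◃ y) x` at `z`. -/
theorem isEdgeCocycle_edge : IsEdgeCocycle (edge (X := X)) := by
  intro x y z
  rw [← sub_eq_zero]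
  refine (Submodule.Quotient.mk_eq_zero _).2
    ⟨Submodule.Quotient.mk (Finsupp.single ![x, y, z] 1), ?_⟩
  rw [qBoundary_mk, boundary_triple]
  simp only [← Submodule.Quotient.mk_add, ← Submodule.Quotient.mk_sub]
  congr 1
  abel

/-- Two homomorphisms on `2`-chains modulo boundaries agree if they agree on edges. -/
theorem chainModBoundary_hom_ext {M : Type*} [AddCommGroup M] {f g : ChainModBoundary X →ₗ[ℤ] M}
    (h : ∀ x z, f (edge x z) = g (edge x z)) : f = g := by
  refine Submodule.linearMap_qext _ (Submodule.linearMap_qext _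
    (Finsupp.lhom_ext' fun p => LinearMap.ext_ring ?_))
  have hp : p = ![p 0, p 1] := by
    funext i; fin_cases i <;> rfl
  rw [hp]
  exact h (p 0) (p 1)

/-- An edge cocycle which vanishes on degenerate edges is a homomorphism on `2`-chains modulo
boundaries. -/
noncomputable def liftEdge {M : Type*} [AddCommGroup M] {w : X → X → M} (hw : IsEdgeCocycle w)
    (hw₀ : ∀ x, w x x = 0) : ChainModBoundary X →ₗ[ℤ] M :=
  (LinearMap.range (qBoundary X 2)).liftQ
    ((degenerate X 2).liftQ (Finsupp.linearCombination ℤ fun p : Fin 2 → X => w (p 0) (p 1)) (by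
      refine Submodule.span_le.2 ?_
      rintro _ ⟨p, ⟨i, j, hij, hp⟩, rfl⟩
      have hi : i = 0 := by ext; simp; omega
      have hj : j = 1 := by ext; simp; omega
      subst hi hj
      simp [hp, hw₀])) (by
    rw [LinearMap.range_le_ker_iff]
    refine Submodule.linearMap_qext _ (Finsupp.lhom_ext' fun p => LinearMap.ext_ring ?_)
    have hp : p = ![p 0, p 1, p 2] := by
      funext i; fin_cases i <;> rfl
    rw [hp]
    change Finsupp.linearCombination ℤ (fun p : Fin 2 → X => w (p 0) (p 1))
      (boundary X 2 (Finsupp.single ![p 0, p 1, p 2] 1)) = 0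
    rw [boundary_triple]
    have := hw (p 0) (p 1) (p 2)
    simp only [map_sub, Finsupp.linearCombination_single, one_smul, Matrix.cons_val_zero,
      Matrix.cons_val_one]
    rw [sub_sub_sub_eq, sub_eq_zero, add_comm, this, add_comm])

theorem liftEdge_edge {M : Type*} [AddCommGroup M] {w : X → X → M} (hw : IsEdgeCocycle w)
    (hw₀ : ∀ x, w x x = 0) (x z : X) : liftEdge hw hw₀ (edge x z) = w x z := by
  change Finsupp.linearCombination ℤ (fun p : Fin 2 → X => w (p 0) (p 1))
    (Finsupp.single ![x, z] 1) = _
  simp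

/-- The class of the path which starts at `z` and spells the group element `g`. -/
noncomputable def pathClass (g : Rack.EnvelGroup X) (z : X) : ChainModBoundary X :=
  extend isEdgeCocycle_edge g z

theorem isCocycle_pathClass : IsCocycle (pathClass (X := X)) :=
  isCocycle_extend isEdgeCocycle_edge

theorem pathClass_toG (x z : X) : pathClass (toG X x) z = edge x z :=
  extend_toG isEdgeCocycle_edge x z

theorem boundaryBar_pathClass (g : Rack.EnvelGroup X) (z : X) :
    boundaryBar X (pathClass g z) = vertex z - vertex (Rack.envelAction g z) := by
  refine (isCocycle_pathClass.map (boundaryBar X)).ext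
    (e := fun g z => vertex z - vertex (Rack.envelAction g z)) ?_ ?_ g z
  · intro g h z
    simp
  · intro x z
    change boundaryBar X _ = _
    rw [pathClass_toG, boundaryBar_edge, envelAction_toG]

end Chains

/-! ### Second homology and the stabilizer -/

section Isomorphism

variable {X : Type*} [Quandle X]

/-- The loop at `x₀` obtained from the arrow `g : z → g z` by going to and from the base point
along the chosen arrows `s z : x₀ → z`. -/
def loop {x₀ : X} {s : X → Rack.EnvelGroup X} (hs : ∀ y, Rack.envelAction (s y) x₀ = y)
    (g : Rack.EnvelGroup X) (z : X) : ↥(stab x₀) :=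
  ⟨(s (Rack.envelAction g z))⁻¹ * g * s z, by
    rw [mem_stab]
    simp only [map_mul, map_inv, Equiv.Perm.mul_apply, hs]
    rw [Equiv.Perm.inv_eq_iff_eq, hs]⟩

theorem coe_loop {x₀ : X} {s : X → Rack.EnvelGroup X} (hs : ∀ y, Rack.envelAction (s y) x₀ = y)
    (g : Rack.EnvelGroup X) (z : X) :
    (loop hs g z : Rack.EnvelGroup X) = (s (Rack.envelAction g z))⁻¹ * g * s z := rfl

theorem loop_mul {x₀ : X} {s : X → Rack.EnvelGroup X} (hs : ∀ y, Rack.envelAction (s y) x₀ = y)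
    (g h : Rack.EnvelGroup X) (z : X) :
    loop hs (g * h) z = loop hs g (Rack.envelAction h z) * loop hs h z := by
  ext
  simp [coe_loop, mul_assoc]

theorem loop_toG_self {x₀ : X} {s : X → Rack.EnvelGroup X}
    (hs : ∀ y, Rack.envelAction (s y) x₀ = y) (x : X) :
    loop hs (toG X x) x = ⟨toG X x₀, toG_mem_stab x₀⟩ := by
  ext
  have h := toG_envelAction (s x) x₀
  rw [hs] at h
  rw [coe_loop, envelAction_toG, Quandle.fix, h]
  simp [mul_assoc]

/-- The class of `g x₀^{-deg g}` in the abelianization of `[G_X, G_X] ∩ Stab(x₀)`. -/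
def stabClass (hX : IsIndecomposable X) (x₀ : X) :
    ↥(stab x₀) →* Abelianization ↥(N X ⊓ stab x₀) :=
  Abelianization.of.comp (stabRetraction hX x₀)

/-- The class of the loop spelled by `g` at `z`, as a cocycle. -/
def loopClass (hX : IsIndecomposable X) {x₀ : X} {s : X → Rack.EnvelGroup X}
    (hs : ∀ y, Rack.envelAction (s y) x₀ = y) (g : Rack.EnvelGroup X) (z : X) :
    Additive (Abelianization ↥(N X ⊓ stab x₀)) :=
  Additive.ofMul (stabClass hX x₀ (loop hs g z))

theorem isCocycle_loopClass (hX : IsIndecomposable X) {x₀ : X} {s : X → Rack.EnvelGroup X}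
    (hs : ∀ y, Rack.envelAction (s y) x₀ = y) : IsCocycle (loopClass hX hs) := by
  intro g h z
  rw [loopClass, loop_mul, map_mul]
  rfl

/-- Evaluating a cocycle on both sides of `x y = (x ◃ y) x` gives an edge cocycle. -/
theorem IsCocycle.isEdgeCocycle {A : Type*} [AddCommGroup A] {d : Rack.EnvelGroup X → X → A}
    (hd : IsCocycle d) : IsEdgeCocycle fun x z => d (toG X x) z := by
  intro x y z
  have h : toG X x * toG X y = toG X (x ◃ y) * toG X x := by
    rw [toG_act, inv_mul_cancel_right]
  have h' := congrArg (fun g => d g z) h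
  simpa only [hd _ _ _, envelAction_toG] using h'

theorem loopClass_toG_self (hX : IsIndecomposable X) {x₀ : X} {s : X → Rack.EnvelGroup X}
    (hs : ∀ y, Rack.envelAction (s y) x₀ = y) (x : X) : loopClass hX hs (toG X x) x = 0 := by
  rw [loopClass, loop_toG_self, stabClass, MonoidHom.comp_apply, stabRetraction_toG, map_one]
  rfl

/-- The homomorphism from `2`-chains modulo boundaries which closes up every edge to a loop. -/
noncomputable def toStab (hX : IsIndecomposable X) {x₀ : X} {s : X → Rack.EnvelGroup X}
    (hs : ∀ y, Rack.envelAction (s y) x₀ = y) :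
    ChainModBoundary X →ₗ[ℤ] Additive (Abelianization ↥(N X ⊓ stab x₀)) :=
  liftEdge (isCocycle_loopClass hX hs).isEdgeCocycle (loopClass_toG_self hX hs)

theorem toStab_edge (hX : IsIndecomposable X) {x₀ : X} {s : X → Rack.EnvelGroup X}
    (hs : ∀ y, Rack.envelAction (s y) x₀ = y) (x z : X) :
    toStab hX hs (edge x z) = loopClass hX hs (toG X x) z :=
  liftEdge_edge _ _ x z

theorem toStab_pathClass (hX : IsIndecomposable X) {x₀ : X} {s : X → Rack.EnvelGroup X}
    (hs : ∀ y, Rack.envelAction (s y) x₀ = y) (g : Rack.EnvelGroup X) (z : X) :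
    toStab hX hs (pathClass g z) = loopClass hX hs g z := by
  refine (isCocycle_pathClass.map (toStab hX hs)).ext
    (isCocycle_loopClass hX hs) (fun x z => ?_) g z
  change toStab hX hs _ = _
  rw [pathClass_toG, toStab_edge]

/-- An element of `[G_X, G_X] ∩ Stab(x₀)` is recovered, up to commutators, from the path which it
spells at `x₀`. -/
theorem toStab_pathClass_base (hX : IsIndecomposable X) {x₀ : X} {s : X → Rack.EnvelGroup X}
    (hs : ∀ y, Rack.envelAction (s y) x₀ = y) (k : ↥(N X ⊓ stab x₀)) :
    toStab hX hs (pathClass k x₀) = Additive.ofMul (Abelianization.of k) := by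
  -- `s x₀` need not be trivial, but it stabilizes `x₀`, so it disappears in the abelianization.
  have h : loop hs k x₀ = (⟨s x₀, mem_stab.2 (hs x₀)⟩ : ↥(stab x₀))⁻¹ * ⟨k, k.2.2⟩ *
      ⟨s x₀, mem_stab.2 (hs x₀)⟩ := by
    ext
    rw [coe_loop, mem_stab.1 k.2.2]
    rfl
  have h' : stabClass hX x₀ (loop hs k x₀) = Abelianization.of k := by
    rw [h, map_mul, map_mul, map_inv, mul_right_comm, inv_mul_cancel, one_mul, stabClass,
      MonoidHom.comp_apply, stabRetraction_of_mem]
  rw [toStab_pathClass, loopClass, h']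

/-- The homomorphism sending an element of `[G_X, G_X] ∩ Stab(x₀)` to the class of the path
which it spells at `x₀`. -/
noncomputable def fromStab (x₀ : X) :
    Abelianization ↥(N X ⊓ stab x₀) →* Multiplicative (ChainModBoundary X) :=
  Abelianization.lift
    ((isCocycle_pathClass.stabHom x₀).comp (Subgroup.inclusion inf_le_right))

theorem fromStab_stabClass (hX : IsIndecomposable X) (x₀ : X) (g : ↥(stab x₀)) :
    fromStab x₀ (stabClass hX x₀ g) =
      Multiplicative.ofAdd (pathClass (g : Rack.EnvelGroup X) x₀) := by
  have h₀ : isCocycle_pathClass.stabHom x₀ ⟨toG X x₀, toG_mem_stab x₀⟩ = 1 := by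
    change Multiplicative.ofAdd (pathClass (toG X x₀) x₀) = 1
    rw [pathClass_toG, edge_self, ofAdd_zero]
  have h : Subgroup.inclusion inf_le_right (stabRetraction hX x₀ g) =
      g * ⟨toG X x₀, toG_mem_stab x₀⟩ ^ (-(degree (g : Rack.EnvelGroup X)).toAdd) := rfl
  rw [stabClass, MonoidHom.comp_apply, fromStab, Abelianization.lift_apply_of,
    MonoidHom.comp_apply, h, map_mul, map_zpow, h₀, one_zpow, mul_one]
  rfl

/-- Closing up the edges of a chain `u` to loops adds to `u` the chosen paths between the base
point and the boundary of `u`. -/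
theorem fromStab_toStab (hX : IsIndecomposable X) {x₀ : X} {s : X → Rack.EnvelGroup X}
    (hs : ∀ y, Rack.envelAction (s y) x₀ = y) (u : ChainModBoundary X) :
    (fromStab x₀ (toStab hX hs u).toMul).toAdd =
      u + liftVertex (fun y => pathClass (s y) x₀) (boundaryBar X u) := by
  have key : (MonoidHom.toAdditiveLeft (fromStab x₀)).toIntLinearMap ∘ₗ toStab hX hs =
      LinearMap.id + liftVertex (fun y => pathClass (s y) x₀) ∘ₗ boundaryBar X := by
    refine chainModBoundary_hom_ext fun x z => ?_
    change (fromStab x₀ (toStab hX hs (edge x z)).toMul).toAdd =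
      edge x z + liftVertex (fun y => pathClass (s y) x₀) (boundaryBar X (edge x z))
    rw [toStab_edge, loopClass, toMul_ofMul, fromStab_stabClass, toAdd_ofAdd, coe_loop,
      boundaryBar_edge, map_sub, liftVertex_vertex, liftVertex_vertex, envelAction_toG,
      isCocycle_pathClass, isCocycle_pathClass, hs, isCocycle_pathClass.inv, pathClass_toG,
      envelAction_toG]
    have : Rack.envelAction (s (x ◃ z))⁻¹ (x ◃ z) = x₀ := by
      rw [map_inv, Equiv.Perm.inv_eq_iff_eq, hs]
    rw [this]
    abel
  exact LinearMap.congr_fun key u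

/-- Second quandle homology consists of the cycles among the `2`-chains modulo boundaries; the
homomorphism `toStab` on them. -/
noncomputable def homologyToStab (hX : IsIndecomposable X) {x₀ : X} {s : X → Rack.EnvelGroup X}
    (hs : ∀ y, Rack.envelAction (s y) x₀ = y) :
    H2Q X →ₗ[ℤ] Additive (Abelianization ↥(N X ⊓ stab x₀)) :=
  Submodule.liftQ _
    (toStab hX hs ∘ₗ (LinearMap.range (qBoundary X 2)).mkQ ∘ₗ
      (LinearMap.ker (qBoundary X 1)).subtype)
    (by
      rintro c hc
      have : (LinearMap.range (qBoundary X 2)).mkQ (c : QChain X 2) = 0 :=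
        (Submodule.Quotient.mk_eq_zero _).2 hc
      rw [LinearMap.mem_ker, LinearMap.comp_apply, LinearMap.comp_apply, Submodule.subtype_apply,
        this, map_zero])

theorem homologyToStab_mk (hX : IsIndecomposable X) {x₀ : X} {s : X → Rack.EnvelGroup X}
    (hs : ∀ y, Rack.envelAction (s y) x₀ = y) (c : LinearMap.ker (qBoundary X 1)) :
    homologyToStab hX hs (Submodule.Quotient.mk c) =
      toStab hX hs (Submodule.Quotient.mk (c : QChain X 2)) := rfl

theorem homologyToStab_bijective (hX : IsIndecomposable X) {x₀ : X} {s : X → Rack.EnvelGroup X}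
    (hs : ∀ y, Rack.envelAction (s y) x₀ = y) : Function.Bijective (homologyToStab hX hs) := by
  constructor
  · rw [injective_iff_map_eq_zero]
    intro a ha
    obtain ⟨c, rfl⟩ := Submodule.Quotient.mk_surjective _ a
    have hc : boundaryBar X (Submodule.Quotient.mk (c : QChain X 2)) = 0 := c.2
    have h := fromStab_toStab hX hs (Submodule.Quotient.mk (c : QChain X 2))
    rw [← homologyToStab_mk, ha, hc, map_zero (liftVertex _), add_zero, toMul_zero, map_one,
      toAdd_one] at h
    exact (Submodule.Quotient.mk_eq_zero _).2 
      ((Submodule.Quotient.mk_eq_zero (LinearMap.range (qBoundary X 2))).1 h.symm)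
  · intro k
    obtain ⟨k, rfl⟩ := Additive.ofMul.surjective k
    obtain ⟨k, rfl⟩ := QuotientGroup.mk'_surjective _ k
    obtain ⟨c, hc⟩ := Submodule.Quotient.mk_surjective _ (pathClass (k : Rack.EnvelGroup X) x₀)
    have hc₀ : qBoundary X 1 c = 0 := by
      change boundaryBar X (Submodule.Quotient.mk c) = 0
      rw [hc, boundaryBar_pathClass, mem_stab.1 k.2.2, sub_self]
    refine ⟨Submodule.Quotient.mk ⟨c, hc₀⟩, ?_⟩
    rw [homologyToStab_mk, hc, toStab_pathClass_base]
    rfl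

theorem nonempty_H2Q_addEquiv (hX : IsIndecomposable X) (x₀ : X) :
    Nonempty (H2Q X ≃+ Additive (Abelianization ↥(N X ⊓ stab x₀))) := by
  choose s hs using exists_envelAction_eq hX x₀
  exact ⟨(LinearEquiv.ofBijective _ (homologyToStab_bijective hX hs)).toAddEquiv⟩

/-- The intersection with `Stab(x₀)`, taken in `G_X`, is the stabilizer in `[G_X, G_X]`. -/
def infStabEquivN₀ (x₀ : X) : ↥(N X ⊓ stab x₀) ≃* ↥(N₀ x₀) where
  toFun g := ⟨⟨g, g.2.1⟩, g.2.2⟩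
  invFun g := ⟨g, g.1.2, g.2⟩
  left_inv _ := rfl
  right_inv _ := rfl
  map_mul' _ _ := rfl

end Isomorphism

end QuandleHomology

theorem mainTheorem6 (X : Type*) [Quandle X] [Finite X]
    (hX : QuandleHomology.IsIndecomposable X) (x₀ : X) :
    -- `H₂^Q(X, ℤ) ≅ ([G_X, G_X] ∩ Stab_{G_X}(x₀))_ab ≅ (N₀)_ab`
    (Nonempty (QuandleHomology.H2Q X ≃+ Additive (Abelianization
        ↥(QuandleHomology.N X ⊓ QuandleHomology.stab x₀))) ∧
      Nonempty (Abelianization ↥(QuandleHomology.N X ⊓ QuandleHomology.stab x₀) ≃*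
        Abelianization ↥(QuandleHomology.N₀ x₀))) ∧
    -- `H₂^Q(X, ℤ) ≅ ([G_X, G_X] ∩ C_{G_X}(x₀))_ab ≅ (N₀)_ab` if `X → G_X` is injective
    (Function.Injective (QuandleHomology.toG X) →
      Nonempty (QuandleHomology.H2Q X ≃+ Additive (Abelianization
        ↥(QuandleHomology.N X ⊓ Subgroup.centralizer {QuandleHomology.toG X x₀}))) ∧
      Nonempty (Abelianization
          ↥(QuandleHomology.N X ⊓ Subgroup.centralizer {QuandleHomology.toG X x₀}) ≃*
        Abelianization ↥(QuandleHomology.N₀ x₀))) := by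
  have h : Nonempty (QuandleHomology.H2Q X ≃+ Additive (Abelianization
        ↥(QuandleHomology.N X ⊓ QuandleHomology.stab x₀))) ∧
      Nonempty (Abelianization ↥(QuandleHomology.N X ⊓ QuandleHomology.stab x₀) ≃*
        Abelianization ↥(QuandleHomology.N₀ x₀)) :=
    ⟨QuandleHomology.nonempty_H2Q_addEquiv hX x₀,
      ⟨(QuandleHomology.infStabEquivN₀ x₀).abelianizationCongr⟩⟩
  refine ⟨h, fun hinj => ?_⟩
  rw [← QuandleHomology.stab_eq_centralizer hinj x₀]
  exact h
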